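/- Let $c,d\in\mathbb{N}$, let $H,Q_1,\dots,Q_c$ be $d\times d$ complex Hermitian matrices, let $q\in\mathbb{R}^c$ and $T>0$. Let $\mathcal{M}_d$ be the set of $d\times d$ matrices $M$ with $0\le M\le I$ and assume that some $M\in\mathcal{M}_d$ satisfies $\operatorname{Tr}[Q_iM]=q_i$ for all $i\in\{1,\dots,c\}$. For $M\in\mathcal{M}_d$ let $S(M)=-\operatorname{Tr}[M\ln M]$ (with $0\ln 0=0$) and let $S_{\mathrm{FD}}(M)=S(M)+S(I-M)$ be the Fermi--Dirac entropy. For $\mu\in\mathbb{R}^c$ write $\mu\cdot q=\sum_i\mu_iq_i$ and $\mu\cdot Q=\sum_i\mu_iQ_i$, and set $$f_T(\mu)=\mu\cdot q-T\operatorname{Tr}\left[\ln\left(e^{-\frac1T(H-\mu\cdot Q)}+I\right)\right],\qquad M_T(\mu)=\left(e^{\frac1T(H-\mu\cdot Q)}+I\right)^{-1}.$$ Then the following hold. 1. The minimum $$F_T=\min_{M\in\mathcal{M}_d}\left\{\operatorname{Tr}[HM]-T\,S_{\mathrm{FD}}(M):\ \operatorname{Tr}[Q_iM]=q_i\ \text{for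 all } i\right\}$$ is attained, and $F_T=\sup_{\mu\in\mathbb{R}^c}f_T(\mu)$. 2. For every $\mu\in\mathbb{R}^c$, the operator $M_T(\mu)$ lies in $\mathcal{M}_d$ and is the unique minimizer over $M\in\mathcal{M}_d$ of the Lagrangian $$L(M,\mu)=\operatorname{Tr}[HM]-T\,S_{\mathrm{FD}}(M)+\sum_{i}\mu_i\left(q_i-\operatorname{Tr}[Q_iM]\right).$$ 3. For every $\mu\in\mathbb{R}^c$, the operator $M_T(\mu)$ is an optimal solution of the constrained minimization problem defining $F_T$ if and only if $\mu$ maximizes $f_T$ over $\mathbb{R}^c$. -/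

import Mathlib

open scoped Matrix ComplexOrder

namespace FermiDirac

noncomputable section

/-- The set of `d × d` measurement operators, i.e. matrices `M` with `0 ≤ M ≤ I` in the Loewner
order (`PosSemidef` includes being Hermitian). -/
def measurementOps (d : ℕ) : Set (Matrix (Fin d) (Fin d) ℂ) :=
  {M | M.PosSemidef ∧ (1 - M).PosSemidef}

/-- The logarithm of a Hermitian matrix, by applying the real logarithm to its eigenvalues
(continuous functional calculus). With `Real.log 0 = 0`, the product `M * matLog M` of a positive
semidefinite `M` obeys the usual convention `0 ln 0 = 0`. -/
def matLog {d : ℕ} (A : Matrix (Fin d) (Fin d) ℂ) : Matrix (Fin d) (Fin d) ℂ :=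
  cfc Real.log A

/-- The von Neumann entropy `S(M) = -Tr[M ln M]`; the trace is real for Hermitian `M`. -/
def vonNeumannEntropy {d : ℕ} (M : Matrix (Fin d) (Fin d) ℂ) : ℝ :=
  -((M * matLog M).trace).re

/-- The Fermi–Dirac entropy `S_FD(M) = S(M) + S(I - M)`. -/
def fdEntropy {d : ℕ} (M : Matrix (Fin d) (Fin d) ℂ) : ℝ :=
  vonNeumannEntropy M + vonNeumannEntropy (1 - M)

/-- The free energy `Tr[H M] - T S_FD(M)`. -/
def freeEnergy {d : ℕ} (T : ℝ) (H M : Matrix (Fin d) (Fin d) ℂ) : ℝ :=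
  ((H * M).trace).re - T * fdEntropy M

/-- The measurement operators satisfying all constraints `Tr[Q_i M] = q_i`. -/
def feasibleOps {c d : ℕ} (Q : Fin c → Matrix (Fin d) (Fin d) ℂ) (q : Fin c → ℝ) :
    Set (Matrix (Fin d) (Fin d) ℂ) :=
  {M | M ∈ measurementOps d ∧ ∀ i, (Q i * M).trace = (q i : ℂ)}

/-- The optimal value `F_T` of the measurement free-energy problem. -/
def optFreeEnergy {c d : ℕ} (T : ℝ) (H : Matrix (Fin d) (Fin d) ℂ)
    (Q : Fin c → Matrix (Fin d) (Fin d) ℂ) (q : Fin c → ℝ) : ℝ :=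
  sInf (freeEnergy T H '' feasibleOps Q q)

/-- The operator `H - μ·Q = H - ∑ i, μ_i Q_i`. -/
def shiftedHam {c d : ℕ} (H : Matrix (Fin d) (Fin d) ℂ)
    (Q : Fin c → Matrix (Fin d) (Fin d) ℂ) (μ : Fin c → ℝ) : Matrix (Fin d) (Fin d) ℂ :=
  H - ∑ i, (μ i : ℂ) • Q i

/-- The temperature-`T` dual objective `f_T(μ) = μ·q - T Tr[ln(e^{-(H - μ·Q)/T} + I)]`. -/
def dualObjective {c d : ℕ} (T : ℝ) (H : Matrix (Fin d) (Fin d) ℂ)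
    (Q : Fin c → Matrix (Fin d) (Fin d) ℂ) (q : Fin c → ℝ) (μ : Fin c → ℝ) : ℝ :=
  ∑ i, μ i * q i
    - T * ((matLog (NormedSpace.exp ((-(1 / T : ℝ) : ℂ) • shiftedHam H Q μ) + 1)).trace).re

/-- The Fermi–Dirac operator `M_T(μ) = (e^{(H - μ·Q)/T} + I)⁻¹`. -/
def fdOperator {c d : ℕ} (T : ℝ) (H : Matrix (Fin d) (Fin d) ℂ)
    (Q : Fin c → Matrix (Fin d) (Fin d) ℂ) (μ : Fin c → ℝ) : Matrix (Fin d) (Fin d) ℂ :=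
  (NormedSpace.exp (((1 / T : ℝ) : ℂ) • shiftedHam H Q μ) + 1)⁻¹

/-- The Lagrangian
`L(M, μ) = Tr[H M] - T S_FD(M) + ∑ i, μ_i (q_i - Tr[Q_i M])`. -/
def lagrangian {c d : ℕ} (T : ℝ) (H : Matrix (Fin d) (Fin d) ℂ)
    (Q : Fin c → Matrix (Fin d) (Fin d) ℂ) (q : Fin c → ℝ)
    (M : Matrix (Fin d) (Fin d) ℂ) (μ : Fin c → ℝ) : ℝ :=
  freeEnergy T H M + ∑ i, μ i * (q i - ((Q i * M).trace).re)

end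

end FermiDirac

/-! Everything rests on a Gibbs variational principle. For Hermitian `A` and `0 ≤ M ≤ 1`, `Tr[AM] -
T S_FD(M) ≥ -T Tr[ln(e^{-A/T} + 1)]`, with equality exactly at the Fermi function of `A`
(`le_freeEnergy_and_eq`, `freeEnergy_cfc_fermi`). Squared eigenvector overlaps weight all the traces
alike (`exists_trace_cfc_mul_cfc`), which reduces it to a scalar inequality.

The multipliers merge with `H` into `H - μ·Q`, so `f_T(μ)` is the minimum of the Lagrangian,
attained only at `M_T(μ)`; weak duality follows.

Gibbs is also tight up to any `ε` (`exists_freeEnergy_le_add`), so the free energy is a supremum of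
affine functions and its epigraph is closed and convex. Truncated, it is compact: the minimum is
attained, and the image under `(M, t) ↦ (Tr[Q_i M], t)` is compact and convex. Separating `(q, α)`
from it, for `α` below the optimum, gives `μ` with `f_T(μ) > α` (`exists_lt_dualObjective`). Mere
feasibility makes the hyperplane non-vertical, so no interior point is needed. -/

namespace FermiDirac

open Matrix

/-! ### Functional calculus and eigenvector overlaps -/

section Calculus

variable {d : ℕ} {A M : Matrix (Fin d) (Fin d) ℂ}

/-- Every function is continuous on the spectrum of a matrix. -/
theorem continuousOn_spectrum (f : ℝ → ℝ) : ContinuousOn f (spectrum ℝ A) :=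
  A.finite_real_spectrum.continuousOn f

/-- The trace of a product of functions of two Hermitian matrices is a weighted sum over pairs of
eigenvalues, with weights the squared overlaps of the eigenvectors. -/
theorem exists_trace_cfc_mul_cfc (hA : A.IsHermitian) (hM : M.IsHermitian) :
    ∃ p : Fin d → Fin d → ℝ, (∀ j k, 0 ≤ p j k) ∧ ∀ f g : ℝ → ℝ,
      ((cfc f A * cfc g M).trace).re =
        ∑ j, ∑ k, p j k * (f (hA.eigenvalues j) * g (hM.eigenvalues k)) := by
  set U := (hA.eigenvectorUnitary : Matrix (Fin d) (Fin d) ℂ) with hU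
  set V := (hM.eigenvectorUnitary : Matrix (Fin d) (Fin d) ℂ) with hV
  refine ⟨fun j k => Complex.normSq ((star U * V) j k), fun j k => Complex.normSq_nonneg _,
    fun f g => ?_⟩
  rw [hA.cfc_eq, hM.cfc_eq, IsHermitian.cfc, IsHermitian.cfc, Unitary.conjStarAlgAut_apply,
    Unitary.conjStarAlgAut_apply, ← hU, ← hV]
  set D : Matrix (Fin d) (Fin d) ℂ := diagonal (RCLike.ofReal ∘ f ∘ hA.eigenvalues) with hD
  set E : Matrix (Fin d) (Fin d) ℂ := diagonal (RCLike.ofReal ∘ g ∘ hM.eigenvalues) with hE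
  have h : (U * D * star U * (V * E * star V)).trace
      = (D * ((star U * V) * E * star (star U * V))).trace := by
    rw [star_mul, star_star, ← trace_mul_comm]
    rw [show V * E * star V * (U * D * star U) = (V * E * star V * U * D) * star U by
      simp only [mul_assoc], trace_mul_comm]
    rw [show star U * (V * E * star V * U * D) = (star U * V * E * (star V * U)) * D by
      simp only [mul_assoc], trace_mul_comm]
  rw [h, hD, hE, trace, Complex.re_sum]
  refine Finset.sum_congr rfl fun j _ => ?_
  rw [diag_apply, diagonal_mul, mul_apply, Finset.mul_sum, Complex.re_sum]
  refine Finset.sum_congr rfl fun k _ => ?_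
  rw [mul_diagonal, star_apply, RCLike.star_def,
    show ∀ a b z w : ℂ, a * (z * b * w) = a * b * (z * w) by intros; ring, Complex.mul_conj]
  simp only [Function.comp_apply, Complex.coe_algebraMap]
  norm_cast
  ring

theorem trace_cfc (hM : M.IsHermitian) (f : ℝ → ℝ) :
    ((cfc f M).trace).re = ∑ k, f (hM.eigenvalues k) := by
  rw [hM.cfc_eq, IsHermitian.cfc, Unitary.conjStarAlgAut_apply, trace_mul_cycle,
    Unitary.coe_star_mul_self, one_mul, trace_diagonal, Complex.re_sum]
  simp

theorem cfc_mul_cfc (f g : ℝ → ℝ) : cfc f A * cfc g A = cfc (fun x => f x * g x) A :=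
  (cfc_mul f g A (continuousOn_spectrum _) (continuousOn_spectrum _)).symm

theorem cfc_cfc (hA : A.IsHermitian) (f g : ℝ → ℝ) : cfc g (cfc f A) = cfc (fun x => g (f x)) A :=
  (cfc_comp' g f A ((A.finite_real_spectrum.image f).continuousOn _)
    (continuousOn_spectrum _) hA.isSelfAdjoint).symm

theorem isHermitian_cfc (f : ℝ → ℝ) : (cfc f A).IsHermitian :=
  cfc_predicate f A

theorem cfc_id_eq (hA : A.IsHermitian) : cfc (fun x : ℝ => x) A = A :=
  cfc_id' ℝ A hA.isSelfAdjoint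

theorem cfc_add_one (hA : A.IsHermitian) (f : ℝ → ℝ) : cfc f A + 1 = cfc (fun x => f x + 1) A := by
  rw [cfc_add A f (fun _ => 1) (continuousOn_spectrum _) (continuousOn_spectrum _),
    cfc_const_one ℝ A hA.isSelfAdjoint]

theorem one_sub_cfc (hA : A.IsHermitian) (f : ℝ → ℝ) : 1 - cfc f A = cfc (fun x => 1 - f x) A := by
  rw [cfc_sub (fun _ => 1) f A (continuousOn_spectrum _) (continuousOn_spectrum _),
    cfc_const_one ℝ A hA.isSelfAdjoint]

open scoped MatrixOrder in
theorem posSemidef_cfc {f : ℝ → ℝ} (hf : ∀ x, 0 ≤ f x) : (cfc f A).PosSemidef :=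
  nonneg_iff_posSemidef.mp (cfc_nonneg fun x _ => hf x)

open scoped Matrix.Norms.L2Operator in
theorem exp_smul_eq_cfc (hA : A.IsHermitian) (r : ℝ) :
    NormedSpace.exp ((r : ℂ) • A) = cfc (fun x => Real.exp (r * x)) A := by
  have h : (r : ℂ) • A = cfc (fun x : ℝ => r * x) A := by
    rw [cfc_const_mul r (fun x : ℝ => x) A (continuousOn_spectrum _), cfc_id_eq hA]
    ext; simp
  rw [h, ← cfc_cfc hA (fun x => r * x) Real.exp]
  exact (CFC.real_exp_eq_normedSpace_exp (isHermitian_cfc _).isSelfAdjoint).symm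

theorem inv_cfc (hA : A.IsHermitian) {f : ℝ → ℝ} (hf : ∀ x, f x ≠ 0) :
    (cfc f A)⁻¹ = cfc (fun x => (f x)⁻¹) A := by
  refine inv_eq_right_inv ?_
  rw [cfc_mul_cfc]
  simp only [mul_inv_cancel₀ (hf _)]
  exact cfc_const_one ℝ A hA.isSelfAdjoint

/-- Functions of two Hermitian matrices that agree wherever the eigenvectors overlap are equal. -/
theorem cfc_eq_cfc_of_overlap (hA : A.IsHermitian) (hM : M.IsHermitian) {p : Fin d → Fin d → ℝ}
    (hp : ∀ f g : ℝ → ℝ, ((cfc f A * cfc g M).trace).re =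
        ∑ j, ∑ k, p j k * (f (hA.eigenvalues j) * g (hM.eigenvalues k)))
    {f g : ℝ → ℝ} (h : ∀ j k, p j k = 0 ∨ f (hA.eigenvalues j) = g (hM.eigenvalues k)) :
    cfc f A = cfc g M := by
  rw [← sub_eq_zero, ← trace_conjTranspose_mul_self_eq_zero_iff]
  have hf : (cfc f A).IsHermitian := isHermitian_cfc f
  have hg : (cfc g M).IsHermitian := isHermitian_cfc g
  have hX := hf.sub hg
  -- A constant `1` in one slot gives the squares the same weights as the cross term, so `Tr[(f(A) -
  -- g(M))²]` is the sum of `p j k * (f a_j - g m_k)²`.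
  have h1 := hp (fun x => f x * f x) (fun _ => 1)
  have h2 := hp (fun _ => 1) (fun x => g x * g x)
  rw [cfc_const_one ℝ M hM.isSelfAdjoint, mul_one, ← cfc_mul_cfc] at h1
  rw [cfc_const_one ℝ A hA.isSelfAdjoint, one_mul, ← cfc_mul_cfc] at h2
  have h3 := hp f g
  have him := (posSemidef_conjTranspose_mul_self (cfc f A - cfc g M)).trace_nonneg
  rw [hX.eq] at him ⊢
  have hre : (((cfc f A - cfc g M) * (cfc f A - cfc g M)).trace).re = 0 := by
    have : ((cfc f A - cfc g M) * (cfc f A - cfc g M)).trace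
        = (cfc f A * cfc f A).trace + (cfc g M * cfc g M).trace
          - (cfc f A * cfc g M).trace - (cfc f A * cfc g M).trace := by
      rw [sub_mul, mul_sub, mul_sub, trace_sub, trace_sub, trace_sub, trace_mul_comm (cfc g M)]
      ring
    rw [this, Complex.sub_re, Complex.sub_re, Complex.add_re, h1, h2, h3]
    simp only [← Finset.sum_add_distrib, ← Finset.sum_sub_distrib]
    refine Finset.sum_eq_zero fun j _ => Finset.sum_eq_zero fun k _ => ?_
    rcases h j k with h | h <;> rw [h] <;> ring
  exact Complex.ext hre (Complex.nonneg_iff.mp him).2.symm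

end Calculus

/-! ### The scalar Gibbs inequality -/

section Scalar

/-- The pointwise Fermi–Dirac entropy. -/
noncomputable def scalarEntropy (m : ℝ) : ℝ := Real.negMulLog m + Real.negMulLog (1 - m)

/-- The Fermi–Dirac distribution. -/
noncomputable def fermi (T x : ℝ) : ℝ := (Real.exp (1 / T * x) + 1)⁻¹

/-- The logarithm of the one-mode grand partition function. -/
noncomputable def logPartition (T x : ℝ) : ℝ := Real.log (Real.exp (-(1 / T) * x) + 1)

theorem fermi_pos (T x : ℝ) : 0 < fermi T x := by unfold fermi; positivity

theorem one_sub_fermi (T x : ℝ) : 1 - fermi T x = (Real.exp (-(1 / T) * x) + 1)⁻¹ := by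
  have := Real.exp_pos (1 / T * x)
  rw [fermi, neg_mul, Real.exp_neg]
  field_simp
  ring

theorem one_sub_fermi_pos (T x : ℝ) : 0 < 1 - fermi T x := by
  rw [one_sub_fermi]; positivity

theorem log_one_sub_fermi (T x : ℝ) : Real.log (1 - fermi T x) = -logPartition T x := by
  rw [one_sub_fermi, Real.log_inv, logPartition]

theorem log_fermi (T x : ℝ) : Real.log (fermi T x) = -(1 / T * x) - logPartition T x := by
  rw [sub_eq_add_neg, ← log_one_sub_fermi, ← Real.log_exp (-(1 / T * x)), ← Real.log_mul (Real.exp_ne_zero _) (one_sub_fermi_pos T x).ne']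
  congr 1
  have := Real.exp_pos (1 / T * x)
  rw [fermi, Real.exp_neg]
  field_simp
  ring

/-- This is `log x < x - 1` at `x = g / m`, multiplied by `m`. Added for `(m, g)` and `(1 - m, 1 -
g)`, the right-hand sides cancel. -/
theorem mul_log_add_negMulLog_lt {m g : ℝ} (hm : 0 ≤ m) (hg : 0 < g) (h : m ≠ g) :
    m * Real.log g + Real.negMulLog m < g - m := by
  rcases hm.eq_or_lt with rfl | hm
  · simpa using hg
  · have h1 := Real.log_lt_sub_one_of_pos (div_pos hg hm) (by rwa [Ne, div_eq_one_iff_eq hm.ne', eq_comm])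
    rw [Real.log_div hg.ne' hm.ne'] at h1
    have h2 := mul_lt_mul_of_pos_left h1 hm
    rw [mul_sub_one, mul_div_cancel₀ _ hm.ne'] at h2
    rw [Real.negMulLog]
    linarith

theorem scalar_gibbs_eq {T : ℝ} (hT : 0 < T) (a : ℝ) :
    a * fermi T a - T * scalarEntropy (fermi T a) = -T * logPartition T a := by
  rw [scalarEntropy, Real.negMulLog, Real.negMulLog, log_one_sub_fermi, log_fermi]
  field_simp
  ring

theorem scalar_gibbs_lt {T : ℝ} (hT : 0 < T) {a m : ℝ} (h0 : 0 ≤ m) (h1 : m ≤ 1)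
    (h : m ≠ fermi T a) : -T * logPartition T a < a * m - T * scalarEntropy m := by
  have e1 := mul_log_add_negMulLog_lt h0 (fermi_pos T a) h
  have e2 := mul_log_add_negMulLog_lt (sub_nonneg.mpr h1) (one_sub_fermi_pos T a)
    (fun e => h (by linarith))
  rw [log_fermi] at e1
  rw [log_one_sub_fermi] at e2
  have e3 : T * (m * (-(1 / T * a) - logPartition T a) + Real.negMulLog m
      + ((1 - m) * -logPartition T a + Real.negMulLog (1 - m))) < T * 0 :=
    mul_lt_mul_of_pos_left (by linarith) hT
  have e4 : T * (1 / T * a) = a := by field_simp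
  rw [scalarEntropy]
  linear_combination e3 + m * e4

theorem scalar_gibbs_le {T : ℝ} (hT : 0 < T) {a m : ℝ} (h0 : 0 ≤ m) (h1 : m ≤ 1) :
    -T * logPartition T a ≤ a * m - T * scalarEntropy m := by
  by_cases h : m = fermi T a
  · rw [h, scalar_gibbs_eq hT]
  · exact (scalar_gibbs_lt hT h0 h1 h).le

theorem logPartition_eq (T x : ℝ) :
    logPartition T x = -(1 / T * x) + logPartition T (-x) := by
  have h1 := log_fermi T x
  rw [fermi, Real.log_inv] at h1
  have : logPartition T (-x) = Real.log (Real.exp (1 / T * x) + 1) := by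
    rw [logPartition, neg_mul_neg]
  linarith

/-- At `m = 0` and `m = 1` the entropy has infinite slope, so tangency there is only approximate.
The witness solves `e^{-a/T} = ε / T`. -/
theorem exists_logPartition_lt (T : ℝ) (hT : 0 < T) {ε : ℝ} (hε : 0 < ε) :
    ∃ a, T * logPartition T a < ε := by
  refine ⟨-(T * Real.log (ε / T)), ?_⟩
  have : logPartition T (-(T * Real.log (ε / T))) < ε / T := by
    have h : -(1 / T) * -(T * Real.log (ε / T)) = Real.log (ε / T) := by field_simp
    rw [logPartition, h, Real.exp_log (by positivity)]
    have := Real.log_lt_sub_one_of_pos (x := ε / T + 1) (by positivity)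
      (by have : 0 < ε / T := by positivity
          linarith)
    linarith
  rwa [lt_div_iff₀ hT, mul_comm] at this

/-- The Fermi–Dirac entropy is the infimum of its tangent lines. -/
theorem exists_scalar_gibbs_approx {T : ℝ} (hT : 0 < T) {m : ℝ} (h0 : 0 ≤ m) (h1 : m ≤ 1)
    {ε : ℝ} (hε : 0 < ε) : ∃ a, a * m - T * scalarEntropy m ≤ -T * logPartition T a + ε := by
  rcases h0.eq_or_lt with rfl | h0
  · obtain ⟨a, ha⟩ := exists_logPartition_lt T hT hε
    exact ⟨a, by simp [scalarEntropy]; linarith⟩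
  rcases h1.eq_or_lt with rfl | h1
  · obtain ⟨a, ha⟩ := exists_logPartition_lt T hT hε
    refine ⟨-a, ?_⟩
    have e : T * (1 / T * a) = a := by field_simp
    rw [logPartition_eq, neg_neg]
    simp only [scalarEntropy, Real.negMulLog_one, sub_self, Real.negMulLog_zero]
    linear_combination ha + e
  · have h1' : 0 < 1 - m := by linarith
    -- For interior `m` the Fermi function can be inverted, and the tangent is exact.
    have e : m = fermi T (T * Real.log ((1 - m) / m)) := by
      rw [fermi, show 1 / T * (T * Real.log ((1 - m) / m)) = Real.log ((1 - m) / m) by field_simp,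
        Real.exp_log (by positivity)]
      field_simp
      ring
    refine ⟨T * Real.log ((1 - m) / m), ?_⟩
    have := scalar_gibbs_eq hT (T * Real.log ((1 - m) / m))
    rw [← e] at this
    linarith

theorem scalarEntropy_nonneg {m : ℝ} (h0 : 0 ≤ m) (h1 : m ≤ 1) : 0 ≤ scalarEntropy m :=
  add_nonneg (Real.negMulLog_nonneg h0 h1)
    (Real.negMulLog_nonneg (by linarith) (by linarith))

end Scalar

end FermiDirac

namespace FermiDirac

open Matrix

/-! ### Compactness and convexity of the measurement operators -/

section MeasurementOps

variable {d : ℕ} {A B M : Matrix (Fin d) (Fin d) ℂ}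

theorem eigenvalues_mem_Icc (hM : M ∈ measurementOps d) (k : Fin d) :
    0 ≤ hM.1.1.eigenvalues k ∧ hM.1.1.eigenvalues k ≤ 1 := by
  refine ⟨hM.1.eigenvalues_nonneg k, ?_⟩
  have h := hM.2.dotProduct_mulVec_nonneg (hM.1.1.eigenvectorBasis k)
  have hn : star (hM.1.1.eigenvectorBasis k : Fin d → ℂ) ⬝ᵥ
      (hM.1.1.eigenvectorBasis k : Fin d → ℂ) = 1 := by
    have := hM.1.1.eigenvectorBasis.orthonormal.1 k
    have h2 := EuclideanSpace.inner_eq_star_dotProduct (hM.1.1.eigenvectorBasis k)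
      (hM.1.1.eigenvectorBasis k)
    rw [inner_self_eq_norm_sq_to_K, this, dotProduct_comm] at h2
    simpa using h2.symm
  rw [sub_mulVec, one_mulVec, IsHermitian.mulVec_eigenvectorBasis, dotProduct_sub, dotProduct_smul,
    hn] at h
  have := (Complex.nonneg_iff.mp h).1
  simpa using this

theorem cfc_mem_measurementOps (hA : A.IsHermitian) {f : ℝ → ℝ} (h0 : ∀ x, 0 ≤ f x)
    (h1 : ∀ x, f x ≤ 1) : cfc f A ∈ measurementOps d := by
  refine ⟨posSemidef_cfc h0, ?_⟩
  rw [one_sub_cfc hA]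
  exact posSemidef_cfc fun x => sub_nonneg.mpr (h1 x)

theorem convex_setOf_posSemidef : Convex ℝ {M : Matrix (Fin d) (Fin d) ℂ | M.PosSemidef} := by
  intro M hM N hN a b ha hb _
  exact (PosSemidef.smul hM ha).add (PosSemidef.smul hN hb)

theorem convex_measurementOps : Convex ℝ (measurementOps d) := by
  intro M hM N hN a b ha hb hab
  refine ⟨convex_setOf_posSemidef hM.1 hN.1 ha hb hab, ?_⟩
  have := convex_setOf_posSemidef hM.2 hN.2 ha hb hab
  rw [Set.mem_ofPred_eq] at this
  convert this using 1
  rw [smul_sub, smul_sub, sub_add_sub_comm, ← add_smul, hab, one_smul]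

theorem isClosed_setOf_posSemidef :
    IsClosed {M : Matrix (Fin d) (Fin d) ℂ | M.PosSemidef} := by
  simp only [posSemidef_iff_dotProduct_mulVec, Set.ofPred_and, Set.ofPred_forall]
  refine IsClosed.inter (isClosed_eq (by fun_prop) (by fun_prop)) (isClosed_iInter fun x => ?_)
  exact isClosed_le (by fun_prop) (by fun_prop)

theorem isClosed_measurementOps : IsClosed (measurementOps d) :=
  isClosed_setOf_posSemidef.inter
    (isClosed_setOf_posSemidef.preimage (f := fun M => 1 - M) (by fun_prop))

/-- Each entry is bounded by the Frobenius norm, and `Tr[M²]` is a sum of `d` squared eigenvalues in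
`[0, 1]`. -/
theorem norm_apply_le_of_mem_measurementOps (hM : M ∈ measurementOps d) (i j : Fin d) :
    ‖M i j‖ ^ 2 ≤ d := by
  have h1 : ((M * Mᴴ).trace).re = ∑ i, ∑ j, ‖M i j‖ ^ 2 := by
    simp only [trace, diag_apply, mul_apply, conjTranspose_apply, Complex.re_sum]
    refine Finset.sum_congr rfl fun i _ => Finset.sum_congr rfl fun j _ => ?_
    rw [RCLike.star_def, Complex.mul_conj, Complex.normSq_eq_norm_sq, Complex.ofReal_re]
  have h2 : ((M * Mᴴ).trace).re ≤ d := by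
    rw [hM.1.1.eq, ← cfc_id_eq hM.1.1, cfc_mul_cfc, trace_cfc hM.1.1]
    calc _ ≤ ∑ _k : Fin d, (1 : ℝ) := Finset.sum_le_sum fun k _ =>
          mul_le_one₀ (eigenvalues_mem_Icc hM k).2 (eigenvalues_mem_Icc hM k).1
            (eigenvalues_mem_Icc hM k).2
      _ = d := by simp
  calc ‖M i j‖ ^ 2 ≤ ∑ j, ‖M i j‖ ^ 2 :=
        Finset.single_le_sum (f := fun j => ‖M i j‖ ^ 2) (fun _ _ => by positivity)
          (Finset.mem_univ j)
    _ ≤ ∑ i, ∑ j, ‖M i j‖ ^ 2 :=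
        Finset.single_le_sum (f := fun i => ∑ j, ‖M i j‖ ^ 2) (fun _ _ => by positivity)
          (Finset.mem_univ i)
    _ ≤ d := h1 ▸ h2

theorem isCompact_measurementOps : IsCompact (measurementOps d) := by
  have hK : IsCompact (Set.univ.pi fun _ : Fin d => Set.univ.pi fun _ : Fin d =>
      Metric.closedBall (0 : ℂ) (Real.sqrt d)) :=
    isCompact_univ_pi fun _ => isCompact_univ_pi fun _ => isCompact_closedBall _ _
  refine IsCompact.of_isClosed_subset hK isClosed_measurementOps fun M hM i _ j _ => ?_
  rw [mem_closedBall_zero_iff]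
  exact Real.le_sqrt_of_sq_le (norm_apply_le_of_mem_measurementOps hM i j)

theorem trace_mul_im (hA : A.IsHermitian) (hB : B.IsHermitian) : ((A * B).trace).im = 0 := by
  have h : star (A * B).trace = (A * B).trace := by
    rw [← trace_conjTranspose, conjTranspose_mul, hA.eq, hB.eq, trace_mul_comm]
  exact Complex.conj_eq_iff_im.mp h

theorem continuous_trace_mul_re (A : Matrix (Fin d) (Fin d) ℂ) :
    Continuous fun M : Matrix (Fin d) (Fin d) ℂ => ((A * M).trace).re := by
  fun_prop

/-- The real part of `Tr[A M]` as a real-linear functional of `M`. -/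
def traceMulRe (A : Matrix (Fin d) (Fin d) ℂ) : Matrix (Fin d) (Fin d) ℂ →ₗ[ℝ] ℝ where
  toFun M := ((A * M).trace).re
  map_add' M N := by rw [mul_add, trace_add, Complex.add_re]
  map_smul' r M := by rw [mul_smul_comm, trace_smul]; simp

end MeasurementOps

/-! ### The matrix Gibbs principle and the epigraph of the free energy -/

section Gibbs

variable {d : ℕ} {A H M : Matrix (Fin d) (Fin d) ℂ} {T : ℝ}

/-- The trace `Tr[ln(e^{-A/T} + I)]`. -/
noncomputable def traceLogPartition (T : ℝ) (A : Matrix (Fin d) (Fin d) ℂ) : ℝ :=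
  ((cfc (logPartition T) A).trace).re

theorem fdEntropy_eq (hM : M.IsHermitian) : fdEntropy M = ((cfc scalarEntropy M).trace).re := by
  have h1 : vonNeumannEntropy M = ((cfc Real.negMulLog M).trace).re := by
    rw [vonNeumannEntropy, matLog]
    nth_rw 1 [← cfc_id_eq hM]
    rw [cfc_mul_cfc, trace_cfc hM, trace_cfc hM, ← Finset.sum_neg_distrib]
    simp [Real.negMulLog]
  have h2 : vonNeumannEntropy (1 - M) = ((cfc (fun x => Real.negMulLog (1 - x)) M).trace).re := by
    have h : 1 - M = cfc (fun x : ℝ => 1 - x) M := by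
      rw [← one_sub_cfc hM, cfc_id_eq hM]
    rw [vonNeumannEntropy, matLog, h, cfc_cfc hM, cfc_mul_cfc, trace_cfc hM, trace_cfc hM,
      ← Finset.sum_neg_distrib]
    simp only [Real.negMulLog, neg_mul]
  rw [fdEntropy, h1, h2, trace_cfc hM, trace_cfc hM, trace_cfc hM, ← Finset.sum_add_distrib]
  rfl

theorem fdEntropy_nonneg (hM : M ∈ measurementOps d) : 0 ≤ fdEntropy M := by
  rw [fdEntropy_eq hM.1.1, trace_cfc hM.1.1]
  exact Finset.sum_nonneg fun k _ =>
    scalarEntropy_nonneg (eigenvalues_mem_Icc hM k).1 (eigenvalues_mem_Icc hM k).2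

theorem freeEnergy_cfc_fermi (hT : 0 < T) (hA : A.IsHermitian) :
    freeEnergy T A (cfc (fermi T) A) = -T * traceLogPartition T A := by
  rw [freeEnergy, fdEntropy_eq (isHermitian_cfc _), cfc_cfc hA, traceLogPartition]
  nth_rw 1 [← cfc_id_eq hA]
  rw [cfc_mul_cfc, trace_cfc hA, trace_cfc hA, trace_cfc hA, Finset.mul_sum, Finset.mul_sum,
    ← Finset.sum_sub_distrib]
  exact Finset.sum_congr rfl fun k _ => scalar_gibbs_eq hT _

/-- The Gibbs variational principle with its equality case. -/
theorem le_freeEnergy_and_eq (hT : 0 < T) (hA : A.IsHermitian) (hM : M ∈ measurementOps d) :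
    -T * traceLogPartition T A ≤ freeEnergy T A M ∧
      (freeEnergy T A M ≤ -T * traceLogPartition T A → M = cfc (fermi T) A) := by
  obtain ⟨p, hp0, hp⟩ := exists_trace_cfc_mul_cfc hA hM.1.1
  have h1 := hp (fun x => x) (fun x => x)
  have h2 := hp (fun _ => 1) scalarEntropy
  have h3 := hp (logPartition T) (fun _ => 1)
  rw [cfc_id_eq hA, cfc_id_eq hM.1.1] at h1
  rw [cfc_const_one ℝ A hA.isSelfAdjoint, one_mul, ← fdEntropy_eq hM.1.1] at h2
  rw [cfc_const_one ℝ M hM.1.1.isSelfAdjoint, mul_one] at h3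
  have key : ∀ j k, 0 ≤ p j k * (hA.eigenvalues j * hM.1.1.eigenvalues k
      - T * scalarEntropy (hM.1.1.eigenvalues k) + T * logPartition T (hA.eigenvalues j)) := by
    intro j k
    have := scalar_gibbs_le hT (a := hA.eigenvalues j) (eigenvalues_mem_Icc hM k).1
      (eigenvalues_mem_Icc hM k).2
    exact mul_nonneg (hp0 j k) (by linarith)
  have hsum : freeEnergy T A M - -T * traceLogPartition T A =
      ∑ j, ∑ k, p j k * (hA.eigenvalues j * hM.1.1.eigenvalues k
      - T * scalarEntropy (hM.1.1.eigenvalues k) + T * logPartition T (hA.eigenvalues j)) := by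
    rw [freeEnergy, traceLogPartition, h1, h2, h3]
    simp only [Finset.mul_sum, ← Finset.sum_sub_distrib]
    refine Finset.sum_congr rfl fun j _ => Finset.sum_congr rfl fun k _ => ?_
    ring
  refine ⟨?_, fun hle => ?_⟩
  · have : 0 ≤ freeEnergy T A M - -T * traceLogPartition T A :=
      hsum ▸ Finset.sum_nonneg fun j _ => Finset.sum_nonneg fun k _ => key j k
    linarith
  · have h0 : ∑ j, ∑ k, p j k * (hA.eigenvalues j * hM.1.1.eigenvalues k
        - T * scalarEntropy (hM.1.1.eigenvalues k) + T * logPartition T (hA.eigenvalues j)) = 0 :=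
      le_antisymm (hsum ▸ by linarith)
        (Finset.sum_nonneg fun j _ => Finset.sum_nonneg fun k _ => key j k)
    have h0' : ∀ j k, p j k * (hA.eigenvalues j * hM.1.1.eigenvalues k
        - T * scalarEntropy (hM.1.1.eigenvalues k) + T * logPartition T (hA.eigenvalues j)) = 0 := by
      intro j k
      have h4 := (Finset.sum_eq_zero_iff_of_nonneg fun j _ =>
        Finset.sum_nonneg fun k _ => key j k).mp h0 j (Finset.mem_univ j)
      exact (Finset.sum_eq_zero_iff_of_nonneg fun k _ => key j k).mp h4 k (Finset.mem_univ k)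
    -- Strictness of the scalar inequality forces `m_k = fermi T a_j` wherever the weight is
    -- nonzero.
    have h5 := cfc_eq_cfc_of_overlap hA hM.1.1 hp (f := fermi T) (g := fun x => x) fun j k => by
      refine or_iff_not_imp_right.mpr fun hne => ?_
      have := scalar_gibbs_lt hT (eigenvalues_mem_Icc hM k).1 (eigenvalues_mem_Icc hM k).2
        (Ne.symm hne)
      exact (mul_eq_zero.mp (h0' j k)).resolve_right (by linarith)
    rw [h5, cfc_id_eq hM.1.1]

/-- The negative entropy is the supremum of its affine minorants given by the Gibbs variational
principle. -/
theorem exists_freeEnergy_le_add (hT : 0 < T) (hM : M ∈ measurementOps d) {ε : ℝ} (hε : 0 < ε) :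
    ∃ A : Matrix (Fin d) (Fin d) ℂ, A.IsHermitian ∧
      freeEnergy T A M ≤ -T * traceLogPartition T A + ε := by
  -- Each of the `d` eigenvalues receives error `ε / (d + 1)`; the `+ 1` covers `d = 0`.
  have hd : (0 : ℝ) < d + 1 := by positivity
  have h : ∀ m : ℝ, ∃ a, 0 ≤ m → m ≤ 1 →
      a * m - T * scalarEntropy m ≤ -T * logPartition T a + ε / (d + 1) := by
    intro m
    by_cases hm : 0 ≤ m ∧ m ≤ 1
    · obtain ⟨a, ha⟩ := exists_scalar_gibbs_approx hT hm.1 hm.2 (div_pos hε hd)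
      exact ⟨a, fun _ _ => ha⟩
    · exact ⟨0, fun h0 h1 => absurd ⟨h0, h1⟩ hm⟩
  choose α hα using h
  refine ⟨cfc α M, isHermitian_cfc α, ?_⟩
  rw [freeEnergy, fdEntropy_eq hM.1.1, traceLogPartition, cfc_cfc hM.1.1]
  nth_rw 2 [← cfc_id_eq hM.1.1]
  rw [cfc_mul_cfc, trace_cfc hM.1.1, trace_cfc hM.1.1, trace_cfc hM.1.1, Finset.mul_sum,
    Finset.mul_sum, ← Finset.sum_sub_distrib]
  calc _ ≤ ∑ k, (-T * logPartition T (α (hM.1.1.eigenvalues k)) + ε / (d + 1)) :=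
        Finset.sum_le_sum fun k _ =>
          hα _ (eigenvalues_mem_Icc hM k).1 (eigenvalues_mem_Icc hM k).2
    _ = ∑ k, (-T * logPartition T (α (hM.1.1.eigenvalues k))) + d * (ε / (d + 1)) := by
        rw [Finset.sum_add_distrib]; simp
    _ ≤ _ := by
        gcongr
        rw [mul_div_assoc', div_le_iff₀ hd]
        linarith

/-- The epigraph of the free energy over the measurement operators. -/
def freeEnergyEpigraph (T : ℝ) (H : Matrix (Fin d) (Fin d) ℂ) :
    Set (Matrix (Fin d) (Fin d) ℂ × ℝ) :=
  {x | x.1 ∈ measurementOps d ∧ freeEnergy T H x.1 ≤ x.2}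

/-- One inclusion is the Gibbs inequality, the other its approximate tightness. Closedness and
convexity can then be read off from half-spaces, without proving the entropy continuous or concave.
-/
theorem freeEnergyEpigraph_eq (hT : 0 < T) (H : Matrix (Fin d) (Fin d) ℂ) :
    freeEnergyEpigraph T H = Prod.fst ⁻¹' measurementOps d ∩
      ⋂ A : {A : Matrix (Fin d) (Fin d) ℂ // A.IsHermitian},
        {x | traceMulRe H x.1 - traceMulRe A.1 x.1 - x.2 ≤ T * traceLogPartition T A.1} := by
  ext ⟨M, t⟩
  simp only [freeEnergyEpigraph, Set.mem_ofPred_eq, Set.mem_inter_iff, Set.mem_preimage,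
    Set.mem_iInter, Subtype.forall]
  refine and_congr_right fun hM => ⟨fun h A hA => ?_, fun h => le_of_forall_pos_le_add fun ε hε => ?_⟩
  · have := (le_freeEnergy_and_eq hT hA hM).1
    simp only [freeEnergy, traceMulRe, LinearMap.coe_mk, AddHom.coe_mk] at *
    linarith
  · obtain ⟨A, hA, h1⟩ := exists_freeEnergy_le_add hT hM hε
    have := h A hA
    simp only [freeEnergy, traceMulRe, LinearMap.coe_mk, AddHom.coe_mk] at *
    linarith

theorem isClosed_freeEnergyEpigraph (hT : 0 < T) (H : Matrix (Fin d) (Fin d) ℂ) :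
    IsClosed (freeEnergyEpigraph T H) := by
  rw [freeEnergyEpigraph_eq hT]
  refine (isClosed_measurementOps.preimage continuous_fst).inter (isClosed_iInter fun A => ?_)
  refine isClosed_le ?_ continuous_const
  exact (((continuous_trace_mul_re H).comp continuous_fst).sub
    ((continuous_trace_mul_re A.1).comp continuous_fst)).sub continuous_snd

theorem convex_freeEnergyEpigraph (hT : 0 < T) (H : Matrix (Fin d) (Fin d) ℂ) :
    Convex ℝ (freeEnergyEpigraph T H) := by
  rw [freeEnergyEpigraph_eq hT]
  refine (convex_measurementOps.linear_preimage
    (LinearMap.fst ℝ (Matrix (Fin d) (Fin d) ℂ) ℝ)).inter (convex_iInter fun A => ?_)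
  exact convex_halfSpace_le ((traceMulRe H ∘ₗ LinearMap.fst ℝ _ ℝ -
    traceMulRe A.1 ∘ₗ LinearMap.fst ℝ _ ℝ - LinearMap.snd ℝ _ ℝ).isLinear) _

theorem isCompact_freeEnergyEpigraph_inter (hT : 0 < T) (hH : H.IsHermitian) (B : ℝ) :
    IsCompact (freeEnergyEpigraph T H ∩ {x | x.2 ≤ B}) := by
  refine IsCompact.of_isClosed_subset
    (isCompact_measurementOps.prod (isCompact_Icc (a := -T * traceLogPartition T H) (b := B)))
    ((isClosed_freeEnergyEpigraph hT H).inter (isClosed_le continuous_snd continuous_const)) ?_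
  rintro ⟨M, t⟩ ⟨⟨hM, h1⟩, h2⟩
  exact ⟨hM, (le_freeEnergy_and_eq hT hH hM).1.trans h1, h2⟩

/-- Truncating the epigraph at height `B` loses no point of the graph. -/
theorem exists_freeEnergy_le (hT : 0 < T) (H : Matrix (Fin d) (Fin d) ℂ) :
    ∃ B, ∀ M ∈ measurementOps d, freeEnergy T H M ≤ B := by
  obtain ⟨B, hB⟩ := isCompact_measurementOps.bddAbove_image
    (continuous_trace_mul_re H).continuousOn
  refine ⟨B, fun M hM => ?_⟩
  have h1 : ((H * M).trace).re ≤ B := hB ⟨M, hM, rfl⟩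
  have h2 := mul_nonneg hT.le (fdEntropy_nonneg hM)
  rw [freeEnergy]
  linarith

end Gibbs

end FermiDirac

namespace FermiDirac

open Matrix

/-! ### Lagrangian duality -/

section Duality

variable {c d : ℕ} {H M : Matrix (Fin d) (Fin d) ℂ} {T : ℝ}
  {Q : Fin c → Matrix (Fin d) (Fin d) ℂ} {q : Fin c → ℝ}

theorem isHermitian_shiftedHam (hH : H.IsHermitian) (hQ : ∀ i, (Q i).IsHermitian)
    (μ : Fin c → ℝ) : (shiftedHam H Q μ).IsHermitian := by
  refine hH.sub ?_
  rw [IsHermitian, conjTranspose_sum]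
  refine Finset.sum_congr rfl fun i _ => ?_
  rw [conjTranspose_smul, (hQ i).eq, RCLike.star_def, Complex.conj_ofReal]

theorem lagrangian_eq (T : ℝ) (H : Matrix (Fin d) (Fin d) ℂ)
    (Q : Fin c → Matrix (Fin d) (Fin d) ℂ) (q : Fin c → ℝ) (M : Matrix (Fin d) (Fin d) ℂ)
    (μ : Fin c → ℝ) :
    lagrangian T H Q q M μ = ∑ i, μ i * q i + freeEnergy T (shiftedHam H Q μ) M := by
  rw [lagrangian, freeEnergy, freeEnergy, shiftedHam, sub_mul, trace_sub, Finset.sum_mul,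
    trace_sum, Complex.sub_re, Complex.re_sum]
  simp only [smul_mul_assoc, trace_smul, smul_eq_mul, Complex.re_ofReal_mul, mul_sub,
    Finset.sum_sub_distrib]
  ring

theorem dualObjective_eq (hH : H.IsHermitian) (hQ : ∀ i, (Q i).IsHermitian) (T : ℝ)
    (q μ : Fin c → ℝ) :
    dualObjective T H Q q μ
      = ∑ i, μ i * q i + -T * traceLogPartition T (shiftedHam H Q μ) := by
  have hA := isHermitian_shiftedHam hH hQ μ
  rw [dualObjective, ← Complex.ofReal_neg, exp_smul_eq_cfc hA, cfc_add_one hA, matLog, cfc_cfc hA,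
    sub_eq_add_neg, neg_mul]
  rfl

theorem fdOperator_eq (hH : H.IsHermitian) (hQ : ∀ i, (Q i).IsHermitian) (T : ℝ)
    (μ : Fin c → ℝ) : fdOperator T H Q μ = cfc (fermi T) (shiftedHam H Q μ) := by
  have hA := isHermitian_shiftedHam hH hQ μ
  rw [fdOperator, exp_smul_eq_cfc hA, cfc_add_one hA, inv_cfc hA fun x => by positivity]
  rfl

theorem fdOperator_mem_measurementOps (hH : H.IsHermitian) (hQ : ∀ i, (Q i).IsHermitian)
    (T : ℝ) (μ : Fin c → ℝ) : fdOperator T H Q μ ∈ measurementOps d := by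
  rw [fdOperator_eq hH hQ]
  exact cfc_mem_measurementOps (isHermitian_shiftedHam hH hQ μ) (fun x => (fermi_pos T x).le)
    fun x => sub_nonneg.mp (one_sub_fermi_pos T x).le

theorem lagrangian_fdOperator (hT : 0 < T) (hH : H.IsHermitian) (hQ : ∀ i, (Q i).IsHermitian)
    (q μ : Fin c → ℝ) :
    lagrangian T H Q q (fdOperator T H Q μ) μ = dualObjective T H Q q μ := by
  rw [lagrangian_eq, dualObjective_eq hH hQ, fdOperator_eq hH hQ,
    freeEnergy_cfc_fermi hT (isHermitian_shiftedHam hH hQ μ)]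

theorem dualObjective_le_lagrangian (hT : 0 < T) (hH : H.IsHermitian)
    (hQ : ∀ i, (Q i).IsHermitian) (q μ : Fin c → ℝ) (hM : M ∈ measurementOps d) :
    dualObjective T H Q q μ ≤ lagrangian T H Q q M μ := by
  rw [lagrangian_eq, dualObjective_eq hH hQ]
  have := (le_freeEnergy_and_eq hT (isHermitian_shiftedHam hH hQ μ) hM).1
  linarith

theorem eq_fdOperator_of_lagrangian_le (hT : 0 < T) (hH : H.IsHermitian)
    (hQ : ∀ i, (Q i).IsHermitian) {q μ : Fin c → ℝ} (hM : M ∈ measurementOps d)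
    (h : lagrangian T H Q q M μ ≤ dualObjective T H Q q μ) : M = fdOperator T H Q μ := by
  rw [lagrangian_eq, dualObjective_eq hH hQ] at h
  rw [fdOperator_eq hH hQ]
  exact (le_freeEnergy_and_eq hT (isHermitian_shiftedHam hH hQ μ) hM).2 (by linarith)

theorem lagrangian_of_feasible (T : ℝ) (H : Matrix (Fin d) (Fin d) ℂ) (hM : M ∈ feasibleOps Q q)
    (μ : Fin c → ℝ) : lagrangian T H Q q M μ = freeEnergy T H M := by
  simp [lagrangian, hM.2]

theorem mem_feasibleOps_iff (hQ : ∀ i, (Q i).IsHermitian) :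
    M ∈ feasibleOps Q q ↔ M ∈ measurementOps d ∧ ∀ i, traceMulRe (Q i) M = q i := by
  refine and_congr_right fun hM => forall_congr' fun i => ?_
  rw [Complex.ext_iff, trace_mul_im (hQ i) hM.1.1]
  simp [traceMulRe]

/-- The map sending `(M, t)` to the constraint values of `M` together with `t`. -/
noncomputable def constraintMap (Q : Fin c → Matrix (Fin d) (Fin d) ℂ) :
    Matrix (Fin d) (Fin d) ℂ × ℝ →ₗ[ℝ] (Fin c → ℝ) × ℝ :=
  ((LinearMap.pi fun i => traceMulRe (Q i)) ∘ₗ LinearMap.fst ℝ _ ℝ).prod (LinearMap.snd ℝ _ ℝ)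

theorem continuous_constraintMap (Q : Fin c → Matrix (Fin d) (Fin d) ℂ) :
    Continuous (constraintMap Q) :=
  (continuous_pi fun i => (continuous_trace_mul_re (Q i)).comp continuous_fst).prodMk
    continuous_snd

theorem exists_isLeast_freeEnergy (hT : 0 < T) (hH : H.IsHermitian)
    (hQ : ∀ i, (Q i).IsHermitian) (hfeas : (feasibleOps Q q).Nonempty) :
    ∃ M ∈ feasibleOps Q q, ∀ N ∈ feasibleOps Q q, freeEnergy T H M ≤ freeEnergy T H N := by
  obtain ⟨B, hB⟩ := exists_freeEnergy_le hT H
  obtain ⟨M₀, hM₀⟩ := hfeas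
  have hK : IsCompact ((freeEnergyEpigraph T H ∩ {x | x.2 ≤ B}) ∩
      {x | ∀ i, traceMulRe (Q i) x.1 = q i}) := by
    refine (isCompact_freeEnergyEpigraph_inter hT hH B).inter_right ?_
    rw [Set.ofPred_forall]
    exact isClosed_iInter fun i => isClosed_eq
      ((continuous_trace_mul_re (Q i)).comp continuous_fst) continuous_const
  obtain ⟨⟨M, t⟩, ⟨⟨⟨hM, hMt⟩, -⟩, hMq⟩, hmin⟩ := hK.exists_isMinOn (f := Prod.snd)
    ⟨(M₀, freeEnergy T H M₀), ⟨⟨hM₀.1, le_rfl⟩, hB _ hM₀.1⟩, ((mem_feasibleOps_iff hQ).mp hM₀).2⟩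
    continuous_snd.continuousOn
  refine ⟨M, (mem_feasibleOps_iff hQ).mpr ⟨hM, hMq⟩, fun N hN => hMt.trans ?_⟩
  exact hmin (show (N, freeEnergy T H N) ∈ _ from
    ⟨⟨⟨hN.1, le_rfl⟩, hB _ hN.1⟩, ((mem_feasibleOps_iff hQ).mp hN).2⟩)

/-- Strong duality: every value strictly below the primal optimum is exceeded by the dual
objective. -/
theorem exists_lt_dualObjective (hT : 0 < T) (hH : H.IsHermitian)
    (hQ : ∀ i, (Q i).IsHermitian) (hfeas : (feasibleOps Q q).Nonempty) {α : ℝ}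
    (hα : ∀ M ∈ feasibleOps Q q, α < freeEnergy T H M) :
    ∃ μ, α < dualObjective T H Q q μ := by
  obtain ⟨B, hB⟩ := exists_freeEnergy_le hT H
  obtain ⟨M₀, hM₀⟩ := hfeas
  set C := constraintMap Q '' (freeEnergyEpigraph T H ∩ {x | x.2 ≤ B}) with hC
  have hcompact : IsCompact C :=
    (isCompact_freeEnergyEpigraph_inter hT hH B).image (continuous_constraintMap Q)
  have hconv : Convex ℝ C := ((convex_freeEnergyEpigraph hT H).inter
    (convex_halfSpace_le (LinearMap.snd ℝ _ ℝ).isLinear B)).linear_image _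
  have hnot : (q, α) ∉ C := by
    rintro ⟨⟨M, t⟩, ⟨⟨hM, hMt⟩, -⟩, h⟩
    have h1 : (fun i => traceMulRe (Q i) M) = q := congrArg Prod.fst h
    have h2 : t = α := congrArg Prod.snd h
    have := hα M ((mem_feasibleOps_iff hQ).mpr ⟨hM, fun i => congrFun h1 i⟩)
    exact absurd (hMt.trans h2.le) (not_le.mpr this)
  have hmem : ∀ M ∈ measurementOps d, ∀ t, freeEnergy T H M ≤ t → t ≤ B →
      ((fun i => traceMulRe (Q i) M), t) ∈ C :=
    fun M hM t h1 h2 => ⟨(M, t), ⟨⟨hM, h1⟩, h2⟩, rfl⟩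
  obtain ⟨f, u, hu, hf⟩ := geometric_hahn_banach_point_closed hconv hcompact.isClosed hnot
  set s := f (0, 1) with hs
  set l : Fin c → ℝ := fun i => f (Pi.single i 1, 0) with hl
  have hfeq : ∀ (y : Fin c → ℝ) (t : ℝ), f (y, t) = ∑ i, y i * l i + t * s := by
    intro y t
    have h1 : (y, t) = ∑ i, y i • ((Pi.single i 1, 0) : (Fin c → ℝ) × ℝ) + t • (0, 1) := by
      refine Prod.ext ?_ ?_
      · simp only [Prod.fst_add, Prod.fst_sum, Prod.smul_fst, smul_zero, add_zero]
        exact pi_eq_sum_univ' y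
      · simp [Prod.snd_sum]
    rw [h1, map_add, map_sum, map_smul]
    simp only [map_smul, smul_eq_mul, hs, hl]
  -- The point `(q, freeEnergy T H M₀)` of `C` lies directly above `(q, α)`, so separating the two
  -- forces a positive vertical component.
  have hspos : 0 < s := by
    have h1 := hu.trans (hf _ (hmem M₀ hM₀.1 _ le_rfl (hB _ hM₀.1)))
    rw [funext ((mem_feasibleOps_iff hQ).mp hM₀).2, hfeq, hfeq] at h1
    have h2 := hα M₀ hM₀
    nlinarith
  -- With this `μ`, `f (y, t) = s * (t - μ·y)`, so on the graph `f` is `s` times the Lagrangian up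
  -- to a constant. Separation at `M_T(μ)`, where the Lagrangian equals `f_T(μ)`, then gives the
  -- bound.
  refine ⟨fun i => -(l i) / s, ?_⟩
  have hM := fdOperator_mem_measurementOps hH hQ T fun i => -(l i) / s
  rw [← lagrangian_fdOperator hT hH hQ]
  set M := fdOperator T H Q fun i => -(l i) / s
  have h1 := hu.trans (hf _ (hmem M hM _ le_rfl (hB _ hM)))
  rw [hfeq, hfeq] at h1
  have h2 : s * ∑ i, -(l i) / s * (q i - ((Q i * M).trace).re)
      = ∑ i, traceMulRe (Q i) M * l i - ∑ i, q i * l i := by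
    rw [Finset.mul_sum, ← Finset.sum_sub_distrib]
    refine Finset.sum_congr rfl fun i _ => ?_
    simp only [traceMulRe, LinearMap.coe_mk, AddHom.coe_mk]
    field_simp
    ring
  rw [lagrangian]
  refine lt_of_mul_lt_mul_left ?_ hspos.le
  rw [mul_add, h2]
  linarith

end Duality

end FermiDirac


/-! ### The main theorem -/

open FermiDirac

theorem mainTheorem1 (c d : ℕ) (T : ℝ) (hT : 0 < T)
    (H : Matrix (Fin d) (Fin d) ℂ) (hH : H.IsHermitian)
    (Q : Fin c → Matrix (Fin d) (Fin d) ℂ) (hQ : ∀ i, (Q i).IsHermitian)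
    (q : Fin c → ℝ)
    (hfeas : (FermiDirac.feasibleOps Q q).Nonempty) :
    -- the minimum defining `F_T` is attained
    IsLeast (FermiDirac.freeEnergy T H '' FermiDirac.feasibleOps Q q)
      (FermiDirac.optFreeEnergy T H Q q) ∧
    -- `F_T` is the supremum of the dual objective
    IsLUB (Set.range (FermiDirac.dualObjective T H Q q))
      (FermiDirac.optFreeEnergy T H Q q) ∧
    -- for every `μ`, `M_T(μ)` is the unique minimizer of the Lagrangian at `μ`
    (∀ μ : Fin c → ℝ,
      FermiDirac.fdOperator T H Q μ ∈ FermiDirac.measurementOps d ∧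
      ∀ M ∈ FermiDirac.measurementOps d, M ≠ FermiDirac.fdOperator T H Q μ →
        FermiDirac.lagrangian T H Q q (FermiDirac.fdOperator T H Q μ) μ
          < FermiDirac.lagrangian T H Q q M μ) ∧
    -- `M_T(μ)` is optimal for the constrained problem exactly when `μ` is optimal for the dual
    (∀ μ : Fin c → ℝ,
      (FermiDirac.fdOperator T H Q μ ∈ FermiDirac.feasibleOps Q q ∧
        FermiDirac.freeEnergy T H (FermiDirac.fdOperator T H Q μ)
          = FermiDirac.optFreeEnergy T H Q q) ↔
      ∀ ν : Fin c → ℝ,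
        FermiDirac.dualObjective T H Q q ν ≤ FermiDirac.dualObjective T H Q q μ) := by
  obtain ⟨M, hM, hmin⟩ := exists_isLeast_freeEnergy hT hH hQ hfeas
  have hleast : IsLeast (freeEnergy T H '' feasibleOps Q q) (freeEnergy T H M) :=
    ⟨⟨M, hM, rfl⟩, by rintro _ ⟨N, hN, rfl⟩; exact hmin N hN⟩
  have hopt : optFreeEnergy T H Q q = freeEnergy T H M := hleast.csInf_eq
  have hweak : ∀ μ, dualObjective T H Q q μ ≤ freeEnergy T H M := fun μ =>
    (dualObjective_le_lagrangian hT hH hQ q μ hM.1).trans_eq (lagrangian_of_feasible T H hM μ)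
  have hlub : IsLUB (Set.range (dualObjective T H Q q)) (freeEnergy T H M) := by
    refine ⟨by rintro _ ⟨μ, rfl⟩; exact hweak μ, fun b hb => le_of_forall_lt fun α hα => ?_⟩
    obtain ⟨μ, hμ⟩ := exists_lt_dualObjective hT hH hQ hfeas
      fun N hN => hα.trans_le (hmin N hN)
    exact hμ.trans_le (hb ⟨μ, rfl⟩)
  rw [hopt]
  refine ⟨hleast, hlub, fun μ => ⟨fdOperator_mem_measurementOps hH hQ T μ, fun N hN hne => ?_⟩,
    fun μ => ⟨fun ⟨hfd, hval⟩ ν => ?_, fun hmax => ?_⟩⟩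
  · rw [lagrangian_fdOperator hT hH hQ]
    exact lt_of_not_ge fun h => hne (eq_fdOperator_of_lagrangian_le hT hH hQ hN h)
  · rw [← lagrangian_fdOperator hT hH hQ q μ, lagrangian_of_feasible T H hfd, hval]
    exact hweak ν
  -- A maximal `μ` closes the duality gap, so the primal optimizer `M` minimizes the Lagrangian at
  -- `μ`; uniqueness identifies it with `M_T(μ)`.
  · have hle : freeEnergy T H M ≤ dualObjective T H Q q μ :=
      hlub.2 (by rintro _ ⟨ν, rfl⟩; exact hmax ν)
    have heq : M = fdOperator T H Q μ := eq_fdOperator_of_lagrangian_le hT hH hQ hM.1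
      ((lagrangian_of_feasible T H hM μ).trans_le hle)
    exact heq ▸ ⟨hM, rfl⟩
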